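/- Let $r\ge 5$ be odd and let $e_1,\dots,e_r$ be the standard basis of $\mathbb{R}^r$. Put $\Pi_+=\{e_i-e_j,\ e_i+e_j : 1\le i<j\le r\}$ and $\alpha_i=e_i-e_{i+1}$ $(1\le i\le r-1)$, $\alpha_r=e_{r-1}+e_r$; write $\rho\le\eta$ if $\eta-\rho\in\sum_{a=1}^r\mathbb{Z}_{\ge 0}\,\alpha_a$, and for $S\subseteq\Pi_+$ let $\mathrm{Adj}(S)=\{\gamma\in\Pi_+ : \gamma\le\beta \text{ for some } \beta\in S\}$. Let $W(D_r)$ be the group of signed permutations of $e_1,\dots,e_r$ with an even number of negative signs. For $u\in W(D_r)$ define $\nu_0(u)=u(\Pi_+)\cap\Pi_+$ and $\nu_k(u)=u(\mathrm{Adj}(\nu_{k-1}(u)))\cap\Pi_+$ for $k\ge 1$, and call $u$ rational if $\nu_k(u)=\varnothing$ for all sufficiently large $k$. For a non-empty $I=\{i_1<\cdots<i_k\}\subseteq\{1,\dots,r-1\}$ let $p_I\in S_r$ be the cycle $i_1\mapsto i_2\mapsto\cdots\mapsto i_k\mapsto r\mapsto i_1$, fixing all other points. Let $u\in W(D_r)$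 be given by $u(e_j)=\varepsilon_j e_{\pi(j)}$ with $\varepsilon_j\in\{\pm1\}$ and $\pi\in S_r$. Then $u$ is rational if and only if one of the following alternatives holds, and these alternatives are mutually exclusive: 1. $\pi=\mathrm{id}$ and $(\varepsilon_1,\dots,\varepsilon_r)=(-1,\dots,-1,+1)$; then $u=w_0$, where $w_0(e_j)=-e_j$ for $j\le r-1$ and $w_0(e_r)=e_r$. 2. There is a non-empty $I\subseteq\{1,\dots,r-1\}$ such that $\pi=p_I$, $\varepsilon_j=-1$ for $1\le j\le r-1$, and $\varepsilon_r=+1$; then $u=c_I$, where $c_I(e_j)=-e_{p_I(j)}$ for $j\le r-1$ and $c_I(e_r)=e_{p_I(r)}$. 3. There is a non-empty $I\subseteq\{1,\dots,r-1\}$ such that $\pi=p_I$, $\varepsilon_{\max I}=+1$, and $\varepsilon_j=-1$ for all $j\ne\max I$; then $u=d_I$, where $d_I(e_j)=-e_{p_I(j)}$ for $j\neq\max I$ and $d_I(e_{\max I})=e_r$. -/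

import Mathlib

namespace TypeD

/- Throughout, the rank is `r = n + 1`.  The coordinates `1, …, r` are the elements of `Fin (n + 1)`,
so the coordinate `r` is `Fin.last n`, and `{1, …, r - 1}` is `Fin n`, embedded by `Fin.castSucc`. -/

/-- The space `ℝ ^ r`. -/
abbrev V (n : ℕ) : Type := Fin (n + 1) → ℝ

/-- The standard basis vector `e_i`. -/
def e {n : ℕ} (i : Fin (n + 1)) : V n := Pi.single i 1

/-- The positive roots `e_i - e_j` and `e_i + e_j`, `i < j`. -/
def posRoots (n : ℕ) : Set (V n) :=
  {v | ∃ i j : Fin (n + 1), i < j ∧ (v = e i - e j ∨ v = e i + e j)}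

/-- The simple roots `e_i - e_{i+1}`, `1 ≤ i ≤ r - 1`, and `e_{r-1} + e_r`. -/
def simpleRoots (n : ℕ) : Set (V n) :=
  {v | ∃ i j : Fin (n + 1), i.val + 1 = j.val ∧ v = e i - e j} ∪
    {v | ∃ i j : Fin (n + 1), i.val + 1 = j.val ∧ j = Fin.last n ∧ v = e i + e j}

/-- The root order: `ρ ≤ η` iff `η - ρ` is a sum of simple roots with coefficients in `ℤ_{≥ 0}`. -/
def RootLE {n : ℕ} (ρ η : V n) : Prop :=
  η - ρ ∈ AddSubmonoid.closure (simpleRoots n)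

/-- `Adj S`: the positive roots that lie below some element of `S`. -/
def Adj {n : ℕ} (S : Set (V n)) : Set (V n) :=
  {γ | γ ∈ posRoots n ∧ ∃ β ∈ S, RootLE γ β}

/-- The signed permutation `e_j ↦ ε_j e_{π j}`. -/
def signedPerm {n : ℕ} (ε : Fin (n + 1) → ℤˣ) (π : Equiv.Perm (Fin (n + 1))) :
    V n ≃ₗ[ℝ] V n where
  toFun x := fun i => ε (π.symm i) • x (π.symm i)
  invFun y := fun j => ε j • y (π j)
  map_add' x y := by
    funext i
    simp
  map_smul' c x := by
    funext i
    exact smul_comm (ε (π.symm i)) c (x (π.symm i))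
  left_inv x := by
    funext j
    simp [smul_smul]
  right_inv y := by
    funext i
    simp [smul_smul]

theorem signedPerm_e {n : ℕ} (ε : Fin (n + 1) → ℤˣ) (π : Equiv.Perm (Fin (n + 1)))
    (j : Fin (n + 1)) : signedPerm ε π (e j) = ε j • e (π j) := by
  funext i
  by_cases h : i = π j
  · subst h
    simp [signedPerm, e]
  · have h' : π.symm i ≠ j := fun hc => h (by simp [← hc])
    simp [signedPerm, e, h, h']

theorem signedPerm_mul {n : ℕ} (ε δ : Fin (n + 1) → ℤˣ) (π σ : Equiv.Perm (Fin (n + 1))) :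
    signedPerm ε π * signedPerm δ σ = signedPerm (fun j => ε (σ j) * δ j) (π * σ) := by
  ext x i
  simp [signedPerm, smul_smul, Equiv.Perm.mul_def]

theorem signedPerm_one {n : ℕ} : signedPerm (fun _ : Fin (n + 1) => 1) 1 = 1 := by
  ext x i
  simp [signedPerm, Equiv.Perm.one_def]

theorem prod_signs {n : ℕ} (ε : Fin (n + 1) → ℤˣ) :
    ∏ j, ε j = (-1) ^ (Finset.univ.filter fun j => ε j = -1).card := by
  rw [← Finset.prod_const, Finset.prod_filter]
  refine Finset.prod_congr rfl fun j _ => ?_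
  rcases Int.units_eq_one_or (ε j) with h | h <;> simp [h]

theorem even_signs_iff {n : ℕ} (ε : Fin (n + 1) → ℤˣ) :
    Even (Finset.univ.filter fun j => ε j = -1).card ↔ ∏ j, ε j = 1 := by
  rw [prod_signs]
  rcases Nat.even_or_odd (Finset.univ.filter fun j => ε j = -1).card with h | h
  · simp [h]
  · simp [h.neg_one_pow, Nat.not_even_iff_odd.mpr h]

/-- The Weyl group `W(D_r)`: the signed permutations of the coordinates of `ℝ ^ r` with an even
number of negative signs. -/
def weylGroup (n : ℕ) : Subgroup (V n ≃ₗ[ℝ] V n) where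
  carrier := {u | ∃ (ε : Fin (n + 1) → ℤˣ) (π : Equiv.Perm (Fin (n + 1))),
    Even (Finset.univ.filter fun j => ε j = -1).card ∧ u = signedPerm ε π}
  mul_mem' := by
    rintro _ _ ⟨ε, π, hε, rfl⟩ ⟨δ, σ, hδ, rfl⟩
    refine ⟨_, _, ?_, signedPerm_mul ε δ π σ⟩
    rw [even_signs_iff] at *
    rw [Finset.prod_mul_distrib, hδ, Equiv.prod_comp σ ε, hε, one_mul]
  one_mem' := ⟨fun _ => 1, 1, by rw [even_signs_iff]; simp, signedPerm_one.symm⟩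
  inv_mem' := by
    rintro _ ⟨ε, π, hε, rfl⟩
    refine ⟨fun j => ε (π⁻¹ j), π⁻¹, ?_, ?_⟩
    · rw [even_signs_iff] at *
      rw [Equiv.prod_comp π⁻¹ ε, hε]
    · rw [inv_eq_iff_mul_eq_one, signedPerm_mul, ← signedPerm_one]
      congr 1
      · funext j
        simp
      · simp

/-- The sequence `ν_0(u) = u(Π₊) ∩ Π₊`, `ν_k(u) = u(Adj ν_{k-1}(u)) ∩ Π₊`. -/
def nu {n : ℕ} (u : weylGroup n) : ℕ → Set (V n)
  | 0 => u.1 '' posRoots n ∩ posRoots n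
  | k + 1 => u.1 '' Adj (nu u k) ∩ posRoots n

/-- `u` is rational if `ν_k(u)` is empty for all sufficiently large `k`. -/
def IsRational {n : ℕ} (u : weylGroup n) : Prop :=
  ∃ K : ℕ, ∀ k ≥ K, nu u k = ∅

/-- For `I = {i_1 < ⋯ < i_k} ⊆ {1, …, r - 1}`, the cycle `p_I = (i_1 i_2 ⋯ i_k r)`, with
`i_1 ↦ i_2 ↦ ⋯ ↦ i_k ↦ r ↦ i_1`. -/
def cyc {n : ℕ} (I : Finset (Fin n)) : Equiv.Perm (Fin (n + 1)) :=
  ((I.sort (· ≤ ·)).map Fin.castSucc ++ [Fin.last n]).formPerm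

/-- The sign vector whose only positive entry is at position `m`. -/
def signsAt {n : ℕ} (m : Fin (n + 1)) : Fin (n + 1) → ℤˣ :=
  fun j => if j = m then 1 else -1

/-- The element `w_0`: `e_j ↦ -e_j` for `j ≤ r - 1` and `e_r ↦ e_r` (for `r` odd this is the longest
element of `W(D_r)`). -/
def w0 (n : ℕ) : V n ≃ₗ[ℝ] V n := signedPerm (signsAt (Fin.last n)) 1

/-- The element `c_I`: `e_j ↦ -e_{p_I(j)}` for `j ≤ r - 1` and `e_r ↦ e_{p_I(r)}`. -/
def cElt {n : ℕ} (I : Finset (Fin n)) : V n ≃ₗ[ℝ] V n :=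
  signedPerm (signsAt (Fin.last n)) (cyc I)

/-- The element `d_I`: `e_j ↦ -e_{p_I(j)}` for `j ≠ max I` and `e_{max I} ↦ e_{p_I(max I)} = e_r`. -/
def dElt {n : ℕ} (I : Finset (Fin n)) (hI : I.Nonempty) : V n ≃ₗ[ℝ] V n :=
  signedPerm (signsAt (I.max' hI).castSucc) (cyc I)

/-- First alternative: `π = id` and the signs are `(-1, …, -1, +1)`. -/
def AltW {n : ℕ} (ε : Fin (n + 1) → ℤˣ) (π : Equiv.Perm (Fin (n + 1))) : Prop :=
  π = 1 ∧ (∀ j : Fin n, ε j.castSucc = -1) ∧ ε (Fin.last n) = 1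

/-- Second alternative, for a given `I`: `π = p_I`, `ε_j = -1` for `j ≤ r - 1`, and `ε_r = +1`. -/
def AltC {n : ℕ} (ε : Fin (n + 1) → ℤˣ) (π : Equiv.Perm (Fin (n + 1))) (I : Finset (Fin n)) :
    Prop :=
  π = cyc I ∧ (∀ j : Fin n, ε j.castSucc = -1) ∧ ε (Fin.last n) = 1

/-- Third alternative, for a given non-empty `I`: `π = p_I`, `ε_{max I} = +1`, and `ε_j = -1` for
`j ≠ max I`. -/
def AltD {n : ℕ} (ε : Fin (n + 1) → ℤˣ) (π : Equiv.Perm (Fin (n + 1))) (I : Finset (Fin n))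
    (hI : I.Nonempty) : Prop :=
  π = cyc I ∧ ε (I.max' hI).castSucc = 1 ∧ ∀ j, j ≠ (I.max' hI).castSucc → ε j = -1

end TypeD

namespace TypeD

open Finset

/-! ### Roots and the root order -/

/-! Write u = `signedPerm ε π`. If γ and uγ are positive roots with γ ≤ uγ, then uγ lies in every
ν_k; a two-cycle γ ≤ uδ, δ ≤ uγ is just as persistent. Since r is odd and the number of minus signs
even, some sign is +1.

If ε_r = +1, pigeonhole arguments produce such persistent roots unless all other signs are -1
(`EventuallyEmpty.eq_signsAt_last`) and π lowers no index except possibly r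
(`EventuallyEmpty.weaklyRaising`). Conversely, under these conditions ν_k contains only differences
e_a - e_b with a growing with k, so it dies out (`WeaklyRaising.nuSeq_subset`).

If ε_r = -1, the sign at π⁻¹(r) must be +1 (`EventuallyEmpty.pos_symm_last`), and conjugation by the
diagram automorphism e_r ↦ -e_r reduces to the first case.

Finally, a permutation lowering no index but r is determined by its fixed points below r, hence is
some p_I (`weaklyRaising_iff`). Empty I gives w_0; for non-empty I the two positions of the plus
sign, r and p_I⁻¹(r) = max I, give c_I and d_I. -/

theorem sub_mem_posRoots {n : ℕ} {i j : Fin (n + 1)} (h : i < j) : e i - e j ∈ posRoots n :=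
  ⟨i, j, h, Or.inl rfl⟩

theorem add_mem_posRoots {n : ℕ} {i j : Fin (n + 1)} (h : i ≠ j) : e i + e j ∈ posRoots n := by
  rcases lt_or_gt_of_ne h with h | h
  · exact ⟨i, j, h, Or.inr rfl⟩
  · exact ⟨j, i, h, Or.inr (add_comm _ _)⟩

theorem sub_mem_closure {n : ℕ} {i j : Fin (n + 1)} (h : i ≤ j) :
    (e i - e j : V n) ∈ AddSubmonoid.closure (simpleRoots n) := by
  obtain ⟨d, hd⟩ := Nat.exists_eq_add_of_le (show i.val ≤ j.val from h)
  induction d generalizing j with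
  | zero =>
    have : i = j := Fin.ext (by omega)
    subst this
    simp
  | succ d ih =>
    have hj : i.val + d < n + 1 := by omega
    have h1 := ih (j := ⟨i.val + d, hj⟩) (by simp [Fin.le_def]) rfl
    have h2 : (e ⟨i.val + d, hj⟩ - e j : V n) ∈ AddSubmonoid.closure (simpleRoots n) :=
      AddSubmonoid.subset_closure (Or.inl ⟨_, _, by simp; omega, rfl⟩)
    simpa using add_mem h1 h2

theorem add_mem_closure_of_lt {n : ℕ} {i j : Fin (n + 1)} (h : i < j) :
    (e i + e j : V n) ∈ AddSubmonoid.closure (simpleRoots n) := by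
  have hn : n - 1 < n + 1 := by omega
  have h' : i.val < j.val := h
  have h1 : (e i - e ⟨n - 1, hn⟩ : V n) ∈ AddSubmonoid.closure (simpleRoots n) :=
    sub_mem_closure (by rw [Fin.le_def]; simp; omega)
  have h2 := sub_mem_closure (Fin.le_last j)
  have h3 : (e ⟨n - 1, hn⟩ + e (Fin.last n) : V n) ∈ AddSubmonoid.closure (simpleRoots n) :=
    AddSubmonoid.subset_closure (Or.inr ⟨_, _, by simp; omega, rfl, rfl⟩)
  convert add_mem (add_mem h1 h2) h3 using 1
  abel

/-- For i = j < r, 2e_i = (e_i - e_r) + (e_i + e_r). The excluded 2e_r = α_r - α_{r-1} is not in the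
cone; this exception causes the side conditions about r below. -/
theorem add_mem_closure {n : ℕ} {i j : Fin (n + 1)} (h : i ≠ j ∨ i ≠ Fin.last n) :
    (e i + e j : V n) ∈ AddSubmonoid.closure (simpleRoots n) := by
  rcases lt_trichotomy i j with hij | rfl | hij
  · exact add_mem_closure_of_lt hij
  · have hi : i < Fin.last n := Fin.lt_last_iff_ne_last.2 (by simpa using h)
    convert add_mem (sub_mem_closure hi.le) (add_mem_closure_of_lt hi) using 1
    abel
  · simpa only [add_comm] using add_mem_closure_of_lt hij

theorem rootLE_sub_sub {n : ℕ} {i k a b : Fin (n + 1)} (h₁ : a ≤ i) (h₂ : k ≤ b) :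
    RootLE (e i - e k) (e a - e b) := by
  unfold RootLE
  convert add_mem (sub_mem_closure h₁) (sub_mem_closure h₂) using 1
  abel

theorem rootLE_add_add {n : ℕ} {i k a b : Fin (n + 1)} (h₁ : a ≤ i) (h₂ : b ≤ k) :
    RootLE (e i + e k) (e a + e b) := by
  unfold RootLE
  convert add_mem (sub_mem_closure h₁) (sub_mem_closure h₂) using 1
  abel

theorem rootLE_sub_add {n : ℕ} {i k a b : Fin (n + 1)} (h₁ : a ≤ i)
    (h₂ : b ≠ k ∨ b ≠ Fin.last n) : RootLE (e i - e k) (e a + e b) := by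
  unfold RootLE
  convert add_mem (sub_mem_closure h₁) (add_mem_closure h₂) using 1
  abel

theorem sum_e {n : ℕ} (s : Finset (Fin (n + 1))) (i : Fin (n + 1)) :
    ∑ j ∈ s, (e i : V n) j = if i ∈ s then 1 else 0 := by
  simp [e, Pi.single_apply]

/-- Partial sums of the coordinates are monotone for the root order. -/
theorem RootLE.sum_Iic_le {n : ℕ} {ρ η : V n} (h : RootLE ρ η) (t : Fin (n + 1)) :
    ∑ j ∈ Iic t, ρ j ≤ ∑ j ∈ Iic t, η j := by
  have key : 0 ≤ ∑ j ∈ Iic t, (η - ρ) j := by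
    refine AddSubmonoid.closure_induction (motive := fun v _ => 0 ≤ ∑ j ∈ Iic t, v j) ?_ (by simp) ?_ h
    · rintro v (⟨i, j, hij, rfl⟩ | ⟨i, j, -, -, rfl⟩)
      · have hlt : i < j := by rw [Fin.lt_def]; omega
        simp only [Pi.sub_apply, sum_sub_distrib, sum_e, mem_Iic]
        by_cases hj : j ≤ t
        · simp [hj, hlt.le.trans hj]
        · simp only [hj, if_false, sub_zero]
          split_ifs <;> norm_num
      · simp only [Pi.add_apply, sum_add_distrib, sum_e]
        split_ifs <;> norm_num
    · intro x y _ _ hx hy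
      simpa [sum_add_distrib] using add_nonneg hx hy
  simpa [sum_sub_distrib] using key

theorem not_rootLE_add_sub {n : ℕ} (i k a b : Fin (n + 1)) :
    ¬ RootLE (e i + e k) (e a - e b) := by
  intro h
  have := h.sum_Iic_le (Fin.last n)
  simp only [Pi.add_apply, Pi.sub_apply, sum_add_distrib, sum_sub_distrib, sum_e, mem_Iic,
    Fin.le_last, if_true] at this
  norm_num at this

theorem RootLE.le_of_sub_sub {n : ℕ} {i k a b : Fin (n + 1)} (hik : i < k)
    (h : RootLE (e i - e k) (e a - e b)) : a ≤ i := by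
  by_contra hai
  -- Up to i, the left root sums to 1, while e_a - e_b with a > i sums to at most 0.
  have := h.sum_Iic_le i
  simp only [Pi.sub_apply, sum_sub_distrib, sum_e, mem_Iic, le_refl, if_true,
    hik.not_ge, hai, if_false] at this
  split_ifs at this <;> norm_num at this

/-! ### The iteration for an arbitrary linear automorphism -/

/-- The sequence `ν_k` attached to a linear automorphism. -/
def nuSeq {n : ℕ} (u : V n ≃ₗ[ℝ] V n) : ℕ → Set (V n)
  | 0 => u '' posRoots n ∩ posRoots n
  | k + 1 => u '' Adj (nuSeq u k) ∩ posRoots n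

theorem nu_eq_nuSeq {n : ℕ} (u : weylGroup n) (k : ℕ) : nu u k = nuSeq u.1 k := by
  induction k with
  | zero => rfl
  | succ k ih => simp only [nu, nuSeq, ih]

/-- The sequence `ν_k` is eventually empty. -/
def EventuallyEmpty {n : ℕ} (u : V n ≃ₗ[ℝ] V n) : Prop :=
  ∃ K : ℕ, ∀ k ≥ K, nuSeq u k = ∅

theorem Adj_mono {n : ℕ} {S T : Set (V n)} (h : S ⊆ T) : Adj S ⊆ Adj T :=
  fun _ ⟨h₁, β, hβ, h₂⟩ => ⟨h₁, β, h hβ, h₂⟩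

/-- A set that regenerates itself under one step of the iteration is never lost. -/
theorem subset_nuSeq {n : ℕ} {u : V n ≃ₗ[ℝ] V n} {T : Set (V n)} (hpos : T ⊆ posRoots n)
    (hT : T ⊆ u '' Adj T) (k : ℕ) : T ⊆ nuSeq u k := by
  induction k with
  | zero =>
    exact fun x hx => ⟨Set.image_mono (fun _ h => h.1) (hT hx), hpos hx⟩
  | succ k ih =>
    exact fun x hx => ⟨Set.image_mono (Adj_mono ih) (hT hx), hpos hx⟩

/-- A two-step cycle prevents the sequence `ν_k` from becoming empty. -/
theorem EventuallyEmpty.not_cycle {n : ℕ} {u : V n ≃ₗ[ℝ] V n} (hu : EventuallyEmpty u)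
    {γ δ : V n} (hγ : γ ∈ posRoots n) (hδ : δ ∈ posRoots n) (huγ : u γ ∈ posRoots n)
    (huδ : u δ ∈ posRoots n) (h₁ : RootLE γ (u δ)) : ¬ RootLE δ (u γ) := by
  intro h₂
  obtain ⟨K, hK⟩ := hu
  have hsub : ({u γ, u δ} : Set (V n)) ⊆ nuSeq u K := by
    refine subset_nuSeq ?_ ?_ K
    · rintro x (rfl | rfl) <;> assumption
    · rintro x (rfl | rfl)
      · exact ⟨γ, ⟨hγ, u δ, by simp, h₁⟩, rfl⟩
      · exact ⟨δ, ⟨hδ, u γ, by simp, h₂⟩, rfl⟩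
  rw [hK K le_rfl] at hsub
  exact hsub (Set.mem_insert _ _)

theorem EventuallyEmpty.not_rootLE {n : ℕ} {u : V n ≃ₗ[ℝ] V n} (hu : EventuallyEmpty u)
    {γ : V n} (hγ : γ ∈ posRoots n) (huγ : u γ ∈ posRoots n) : ¬ RootLE γ (u γ) :=
  fun h => hu.not_cycle hγ hγ huγ huγ h h

/-- The iteration uses only the positive roots and their order, so an automorphism of both
transports it. -/
theorem nuSeq_conj {n : ℕ} {s u w : V n ≃ₗ[ℝ] V n} (hpos : s '' posRoots n = posRoots n)
    (hle : ∀ ρ η, RootLE (s ρ) (s η) ↔ RootLE ρ η) (hw : ∀ x, w (s x) = s (u x)) (k : ℕ) :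
    nuSeq w k = s '' nuSeq u k := by
  have himg : ∀ S : Set (V n), w '' (s '' S) = s '' (u '' S) := by
    intro S
    simp only [Set.image_image, hw]
  have hmem : ∀ x, s x ∈ posRoots n ↔ x ∈ posRoots n := by
    intro x
    conv_lhs => rw [← hpos]
    exact s.injective.mem_set_image
  have hadj : ∀ S : Set (V n), Adj (s '' S) = s '' Adj S := by
    intro S
    ext x
    obtain ⟨y, rfl⟩ := s.surjective x
    rw [s.injective.mem_set_image]
    simp [Adj, hmem, hle]
  induction k with
  | zero =>
    simp only [nuSeq]
    rw [Set.image_inter s.injective, hpos, ← himg, hpos]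
  | succ k ih =>
    simp only [nuSeq]
    rw [Set.image_inter s.injective, hpos, ← himg, ih, hadj]

theorem EventuallyEmpty.conj {n : ℕ} {s u w : V n ≃ₗ[ℝ] V n}
    (hpos : s '' posRoots n = posRoots n) (hle : ∀ ρ η, RootLE (s ρ) (s η) ↔ RootLE ρ η)
    (hw : ∀ x, w (s x) = s (u x)) (hu : EventuallyEmpty u) : EventuallyEmpty w := by
  obtain ⟨K, hK⟩ := hu
  exact ⟨K, fun k hk => by rw [nuSeq_conj hpos hle hw, hK k hk, Set.image_empty]⟩

/-! ### The diagram automorphism -/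

/-- The sign vector whose only negative entry is the last one. -/
def lastSign {n : ℕ} (j : Fin (n + 1)) : ℤˣ := if j = Fin.last n then -1 else 1

theorem lastSign_mul_self {n : ℕ} (j : Fin (n + 1)) : lastSign j * lastSign j = 1 := by
  simp [Int.units_mul_self]

/-- The reflection in the last coordinate. -/
def flipLast (n : ℕ) : V n ≃ₗ[ℝ] V n := signedPerm lastSign 1

theorem flipLast_e {n : ℕ} (j : Fin (n + 1)) : flipLast n (e j) = lastSign j • e j := by
  simp [flipLast, signedPerm_e]

theorem flipLast_flipLast {n : ℕ} (x : V n) : flipLast n (flipLast n x) = x := by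
  have h : flipLast n * flipLast n = 1 := by
    rw [flipLast, signedPerm_mul, ← signedPerm_one]
    congr 1
    funext j
    exact lastSign_mul_self j
  exact congrArg (fun f : V n ≃ₗ[ℝ] V n => f x) h

theorem flipLast_mem_posRoots {n : ℕ} {x : V n} (h : x ∈ posRoots n) :
    flipLast n x ∈ posRoots n := by
  obtain ⟨i, j, hij, h⟩ := h
  have hi : i ≠ Fin.last n := (hij.trans_le (Fin.le_last j)).ne
  rcases h with rfl | rfl <;> refine ⟨i, j, hij, ?_⟩ <;> by_cases hj : j = Fin.last n <;>
    simp [map_add, flipLast_e, lastSign, hi, hj, Units.smul_def, sub_eq_add_neg]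

theorem flipLast_mem_simpleRoots {n : ℕ} {x : V n} (h : x ∈ simpleRoots n) :
    flipLast n x ∈ simpleRoots n := by
  have key : ∀ i j : Fin (n + 1), i.val + 1 = j.val → i ≠ Fin.last n := by
    rintro i j hij rfl
    have := j.isLt
    simp at hij
    omega
  rcases h with ⟨i, j, hij, rfl⟩ | ⟨i, j, hij, hj, rfl⟩
  · by_cases hj : j = Fin.last n
    · exact Or.inr ⟨i, j, hij, hj, by
        simp [map_sub, flipLast_e, lastSign, key i j hij, hj, Units.smul_def]⟩
    · exact Or.inl ⟨i, j, hij, by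
        simp [map_sub, flipLast_e, lastSign, key i j hij, hj]⟩
  · exact Or.inl ⟨i, j, hij, by
      simp [map_add, flipLast_e, lastSign, key i j hij, hj, Units.smul_def, sub_eq_add_neg]⟩

theorem flipLast_image_posRoots (n : ℕ) : flipLast n '' posRoots n = posRoots n := by
  apply Set.Subset.antisymm
  · rintro _ ⟨x, hx, rfl⟩
    exact flipLast_mem_posRoots hx
  · exact fun x hx => ⟨_, flipLast_mem_posRoots hx, flipLast_flipLast x⟩

theorem RootLE.flipLast {n : ℕ} {ρ η : V n} (h : RootLE ρ η) :
    RootLE (flipLast n ρ) (flipLast n η) := by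
  unfold RootLE at *
  rw [← map_sub]
  refine AddSubmonoid.closure_induction
    (motive := fun v _ => TypeD.flipLast n v ∈ AddSubmonoid.closure (simpleRoots n)) ?_ ?_ ?_ h
  · exact fun x hx => AddSubmonoid.subset_closure (flipLast_mem_simpleRoots hx)
  · rw [map_zero]
    exact zero_mem _
  · intro x y _ _ hx hy
    rw [map_add]
    exact add_mem hx hy

theorem rootLE_flipLast_iff {n : ℕ} (ρ η : V n) :
    RootLE (flipLast n ρ) (flipLast n η) ↔ RootLE ρ η :=
  ⟨fun h => by simpa only [flipLast_flipLast] using h.flipLast, RootLE.flipLast⟩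

theorem EventuallyEmpty.flipLast {n : ℕ} {ε : Fin (n + 1) → ℤˣ} {π : Equiv.Perm (Fin (n + 1))}
    (h : EventuallyEmpty (signedPerm ε π)) :
    EventuallyEmpty (signedPerm (fun j => lastSign (π j) * ε j * lastSign j) π) := by
  refine h.conj (flipLast_image_posRoots n) rootLE_flipLast_iff fun x => ?_
  have hmul : signedPerm (fun j => lastSign (π j) * ε j * lastSign j) π * TypeD.flipLast n =
      TypeD.flipLast n * signedPerm ε π := by
    rw [TypeD.flipLast, signedPerm_mul, signedPerm_mul]
    congr 1
    funext j
    simp [mul_assoc]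
  exact congrArg (fun f : V n ≃ₗ[ℝ] V n => f x) hmul

/-! ### Obstructions to an eventually empty sequence -/

/-- Otherwise π would inject [i, r] into (i, r]. -/
theorem exists_ge_apply_le {n : ℕ} (π : Equiv.Perm (Fin (n + 1))) (i : Fin (n + 1)) :
    ∃ k, i ≤ k ∧ π k ≤ i := by
  by_contra! h
  have hcard : (Ici i).card ≤ (Ioi i).card :=
    card_le_card_of_injOn π (fun k hk => by simpa using h k (by simpa using hk))
      π.injective.injOn
  have := i.isLt
  rw [Fin.card_Ici, Fin.card_Ioi] at hcard
  omega

section Obstructions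

variable {n : ℕ} {ε : Fin (n + 1) → ℤˣ} {π : Equiv.Perm (Fin (n + 1))}

/-- The root e_i - e_k maps to e_{π i} + e_{π k}, which lies above it if either index is at most i;
`h` rules out a leftover 2e_r in the difference. -/
theorem EventuallyEmpty.lt_apply_of_pos_neg (hu : EventuallyEmpty (signedPerm ε π))
    {i k : Fin (n + 1)} (hik : i < k) (hi : ε i = 1) (hk : ε k = -1)
    (h : k ≠ Fin.last n ∨ (π i ≠ Fin.last n ∧ π k ≠ Fin.last n)) : i < π i ∧ i < π k := by
  have himg : signedPerm ε π (e i - e k) = e (π i) + e (π k) := by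
    simp [signedPerm_e, hi, hk]
  have hne : π i ≠ π k := π.injective.ne hik.ne
  have hn := hu.not_rootLE (sub_mem_posRoots hik) (by rw [himg]; exact add_mem_posRoots hne)
  rw [himg] at hn
  constructor
  · by_contra! hle
    refine hn (rootLE_sub_add hle ?_)
    by_contra! hc
    rcases h with h | h
    · exact h (hc.1 ▸ hc.2)
    · exact h.2 hc.2
  · by_contra! hle
    rw [add_comm (e (π i))] at hn
    refine hn (rootLE_sub_add hle ?_)
    by_contra! hc
    rcases h with h | h
    · exact h (hc.1 ▸ hc.2)
    · exact h.1 hc.2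

theorem EventuallyEmpty.lt_apply_of_pos_last (hu : EventuallyEmpty (signedPerm ε π))
    {i : Fin (n + 1)} (hil : i < Fin.last n) (hi : ε i = 1) (hl : ε (Fin.last n) = 1) :
    i < π i ∧ i < π (Fin.last n) := by
  have himg : signedPerm ε π (e i + e (Fin.last n)) = e (π i) + e (π (Fin.last n)) := by
    simp [signedPerm_e, hi, hl]
  have hn := hu.not_rootLE (add_mem_posRoots hil.ne)
    (by rw [himg]; exact add_mem_posRoots (π.injective.ne hil.ne))
  rw [himg] at hn
  constructor
  · by_contra! hle
    exact hn (rootLE_add_add hle (Fin.le_last _))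
  · by_contra! hle
    rw [add_comm (e (π i))] at hn
    exact hn (rootLE_add_add hle (Fin.le_last _))

theorem EventuallyEmpty.not_nested_of_neg (hu : EventuallyEmpty (signedPerm ε π))
    {i k : Fin (n + 1)} (hik : i < k) (hi : ε i = -1) (hk : ε k = -1) (h₁ : π k ≤ i) :
    π i < k := by
  by_contra! h₂
  have himg : signedPerm ε π (e i - e k) = e (π k) - e (π i) := by
    simp [signedPerm_e, hi, hk, sub_eq_add_neg, add_comm]
  refine hu.not_rootLE (sub_mem_posRoots hik) ?_ ?_ <;> rw [himg]
  · exact sub_mem_posRoots (h₁.trans_lt (hik.trans_le h₂))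
  · exact rootLE_sub_sub h₁ h₂

theorem EventuallyEmpty.eq_signsAt_last (hu : EventuallyEmpty (signedPerm ε π))
    (hl : ε (Fin.last n) = 1) : ε = signsAt (Fin.last n) := by
  suffices h : ∀ k, k ≠ Fin.last n → ε k = -1 by
    funext k
    by_cases hk : k = Fin.last n
    · simp [signsAt, hk, hl]
    · simp [signsAt, hk, h k hk]
  by_contra! hex
  obtain ⟨k₀, hk₀, hk₀'⟩ := hex
  obtain ⟨i, hi, hmax⟩ := exists_max_image
    (univ.filter fun k => k ≠ Fin.last n ∧ ε k = 1) id
    ⟨k₀, by simpa using ⟨hk₀, (Int.units_eq_one_or _).resolve_right hk₀'⟩⟩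
  simp only [mem_filter, mem_univ, true_and, id] at hi hmax
  have hil : i < Fin.last n := Fin.lt_last_iff_ne_last.2 hi.1
  -- With i the largest positive position below r, every possible k (i itself, r, or a negative
  -- position) contradicts an obstruction.
  obtain ⟨k, hik, hk⟩ := exists_ge_apply_le π i
  have hlast := hu.lt_apply_of_pos_last hil hi.2 hl
  rcases hik.eq_or_lt with rfl | hik
  · exact hk.not_gt hlast.1
  by_cases hkl : k = Fin.last n
  · exact hk.not_gt (hkl ▸ hlast.2)
  have hεk : ε k = -1 :=
    (Int.units_eq_one_or _).resolve_left fun h => hik.not_ge (hmax k ⟨hkl, h⟩)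
  exact hk.not_gt (hu.lt_apply_of_pos_neg hik hi.2 hεk (Or.inl hkl)).2

/-- The permutation moves no element other than the last one downwards. -/
def WeaklyRaising (π : Equiv.Perm (Fin (n + 1))) : Prop :=
  ∀ k, k ≠ Fin.last n → k ≤ π k

theorem EventuallyEmpty.weaklyRaising
    (hu : EventuallyEmpty (signedPerm (signsAt (Fin.last n)) π)) : WeaklyRaising π := by
  intro k
  induction k using WellFoundedLT.induction with
  | ind k ih =>
    intro hkl
    by_contra! hlt
    have hne : ∀ i, i < k → i ≠ Fin.last n := fun i hi => (hi.trans_le (Fin.le_last k)).ne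
    -- Induction keeps these indices from descending, non-nesting keeps them below k, and the value
    -- π k is already taken.
    have hmaps : ∀ i ∈ Ico (π k) k, π i ∈ Ioo (π k) k := by
      intro i hi
      rw [mem_Ico] at hi
      refine mem_Ioo.2 ⟨(hi.1.trans (ih i hi.2 (hne i hi.2))).lt_of_ne ?_, ?_⟩
      · exact π.injective.ne hi.2.ne'
      · exact hu.not_nested_of_neg hi.2 (by simp [signsAt, hne i hi.2]) (by simp [signsAt, hkl])
          hi.1
    have hcard := card_le_card_of_injOn π hmaps π.injective.injOn
    rw [Fin.card_Ico, Fin.card_Ioo] at hcard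
    have : (π k).val < k.val := hlt
    omega

theorem EventuallyEmpty.pos_symm_last (hu : EventuallyEmpty (signedPerm ε π))
    (hl : ε (Fin.last n) = -1) (hex : ∃ i, ε i = 1) : ε (π.symm (Fin.last n)) = 1 := by
  obtain ⟨k₀, hk₀⟩ := hex
  obtain ⟨i, hi, hmax⟩ := exists_max_image (univ.filter fun k => ε k = 1) id
    ⟨k₀, by simpa using hk₀⟩
  simp only [mem_filter, mem_univ, true_and, id] at hi hmax
  have hneg : ∀ k, i < k → ε k = -1 := fun k hik =>
    (Int.units_eq_one_or _).resolve_left fun h => hik.not_ge (hmax k h)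
  have hil : i < Fin.last n := by
    refine Fin.lt_last_iff_ne_last.2 fun h => ?_
    rw [h, hl] at hi
    exact absurd hi (by decide)
  by_contra hcon
  have hπi : π i ≠ Fin.last n := fun h => hcon (by rw [← h]; simpa using hi)
  obtain ⟨k, hik, hk⟩ := exists_ge_apply_le π i
  by_cases hπl : π (Fin.last n) = Fin.last n
  · have hkl : k ≠ Fin.last n := by
      rintro rfl
      exact hk.not_gt (hil.trans_eq hπl.symm)
    rcases hik.eq_or_lt with rfl | hik
    · have himg₁ : signedPerm ε π (e i - e (Fin.last n)) = e (π i) + e (Fin.last n) := by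
        simp [signedPerm_e, hi, hl, hπl]
      have himg₂ : signedPerm ε π (e i + e (Fin.last n)) = e (π i) - e (Fin.last n) := by
        simp [signedPerm_e, hi, hl, hπl, sub_eq_add_neg]
      -- A one-step obstruction can fail here because of 2e_r, so e_i - e_r and e_i + e_r are played
      -- against each other.
      refine hu.not_cycle (sub_mem_posRoots hil) (add_mem_posRoots hil.ne) ?_ ?_ ?_ ?_
      · rw [himg₁]
        exact add_mem_posRoots hπi
      · rw [himg₂]
        exact sub_mem_posRoots (hk.trans_lt hil)
      · rw [himg₂]
        exact rootLE_sub_sub hk le_rfl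
      · rw [himg₁]
        exact rootLE_add_add hk le_rfl
    · exact hk.not_gt (hu.lt_apply_of_pos_neg hik hi (hneg k hik) (Or.inl hkl)).2
  · rcases hik.eq_or_lt with rfl | hik
    · exact hk.not_gt (hu.lt_apply_of_pos_neg hil hi hl (Or.inr ⟨hπi, hπl⟩)).1
    · refine hk.not_gt (hu.lt_apply_of_pos_neg hik hi (hneg k hik) ?_).2
      by_cases hkl : k = Fin.last n
      · exact Or.inr ⟨hπi, hkl ▸ hπl⟩
      · exact Or.inl hkl

/-! ### Weakly raising permutations give eventually empty sequences -/

theorem neg_sub_notMem_posRoots (i j : Fin (n + 1)) : (-e i - e j : V n) ∉ posRoots n := by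
  rintro ⟨a, b, -, h⟩
  have hsum : ∑ t, (-e i - e j : V n) t = -2 := by
    simp only [Pi.sub_apply, Pi.neg_apply, sum_sub_distrib, sum_neg_distrib, sum_e, mem_univ,
      if_true]
    norm_num
  rcases h with h | h <;> rw [h] at hsum
  · simp only [Pi.sub_apply, sum_sub_distrib, sum_e, mem_univ, if_true] at hsum
    norm_num at hsum
  · simp only [Pi.add_apply, sum_add_distrib, sum_e, mem_univ, if_true] at hsum
    norm_num at hsum

theorem signedPerm_signsAt_last_sub {i j : Fin (n + 1)} (hij : i < j)
    (h : signedPerm (signsAt (Fin.last n)) π (e i - e j) ∈ posRoots n) :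
    j ≠ Fin.last n ∧
      signedPerm (signsAt (Fin.last n)) π (e i - e j) = e (π j) - e (π i) := by
  have hi : i ≠ Fin.last n := (hij.trans_le (Fin.le_last j)).ne
  by_cases hj : j = Fin.last n
  · refine absurd h ?_
    have : signedPerm (signsAt (Fin.last n)) π (e i - e j) = -e (π i) - e (π j) := by
      simp [signedPerm_e, signsAt, hi, hj]
    rw [this]
    exact neg_sub_notMem_posRoots _ _
  · exact ⟨hj, by simp [signedPerm_e, signsAt, hi, hj, sub_eq_add_neg, add_comm]⟩

theorem signedPerm_signsAt_last_add {i j : Fin (n + 1)} (hij : i < j)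
    (h : signedPerm (signsAt (Fin.last n)) π (e i + e j) ∈ posRoots n) :
    signedPerm (signsAt (Fin.last n)) π (e i + e j) = e (π j) - e (π i) := by
  have hi : i ≠ Fin.last n := (hij.trans_le (Fin.le_last j)).ne
  by_cases hj : j = Fin.last n
  · simp [signedPerm_e, signsAt, hi, hj, sub_eq_add_neg, add_comm]
  · refine absurd h ?_
    have : signedPerm (signsAt (Fin.last n)) π (e i + e j) = -e (π i) - e (π j) := by
      simp [signedPerm_e, signsAt, hi, hj, sub_eq_add_neg]
    rw [this]
    exact neg_sub_notMem_posRoots _ _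

theorem WeaklyRaising.nuSeq_subset (hπ : WeaklyRaising π) (k : ℕ) :
    nuSeq (signedPerm (signsAt (Fin.last n)) π) k ⊆
      {v | ∃ a b : Fin (n + 1), k ≤ a.val ∧ v = e a - e b} := by
  induction k with
  | zero =>
    rintro _ ⟨⟨γ, ⟨i, j, hij, rfl | rfl⟩, rfl⟩, hpos⟩
    · exact ⟨π j, π i, Nat.zero_le _, (signedPerm_signsAt_last_sub hij hpos).2⟩
    · exact ⟨π j, π i, Nat.zero_le _, signedPerm_signsAt_last_add hij hpos⟩
  | succ k ih =>
    rintro _ ⟨⟨γ, ⟨⟨i, j, hij, hγ⟩, β, hβ, hle⟩, rfl⟩, hpos⟩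
    obtain ⟨a, b, hka, rfl⟩ := ih hβ
    rcases hγ with rfl | rfl
    · obtain ⟨hj, himg⟩ := signedPerm_signsAt_last_sub hij hpos
      refine ⟨π j, π i, ?_, himg⟩
      -- The leading index strictly rises: a ≤ i < j ≤ π j.
      have h₁ : a.val ≤ i.val := hle.le_of_sub_sub hij
      have h₂ : i.val < j.val := hij
      have h₃ : j.val ≤ (π j).val := hπ j hj
      omega
    · exact absurd hle (not_rootLE_add_sub i j a b)

theorem WeaklyRaising.eventuallyEmpty (hπ : WeaklyRaising π) :
    EventuallyEmpty (signedPerm (signsAt (Fin.last n)) π) := by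
  refine ⟨n + 1, fun k hk => Set.eq_empty_of_forall_notMem fun v hv => ?_⟩
  obtain ⟨a, -, ha, -⟩ := hπ.nuSeq_subset k hv
  have := a.isLt
  omega

/-- Conjugation by the diagram automorphism moves the plus sign from r to π⁻¹(r). -/
theorem lastSign_mul_signsAt (π : Equiv.Perm (Fin (n + 1))) (j : Fin (n + 1)) :
    lastSign (π j) * signsAt (Fin.last n) j * lastSign j = signsAt (π.symm (Fin.last n)) j := by
  have h : j = π.symm (Fin.last n) ↔ π j = Fin.last n := Equiv.eq_symm_apply π
  simp only [lastSign, signsAt, h]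
  split_ifs <;> rfl

theorem eventuallyEmpty_signedPerm_iff (hex : ∃ i, ε i = 1) :
    EventuallyEmpty (signedPerm ε π) ↔ WeaklyRaising π ∧
      (ε = signsAt (Fin.last n) ∨ ε = signsAt (π.symm (Fin.last n))) := by
  constructor
  · intro hu
    rcases Int.units_eq_one_or (ε (Fin.last n)) with hl | hl
    · have hε := hu.eq_signsAt_last hl
      subst hε
      exact ⟨hu.weaklyRaising, Or.inl rfl⟩
    · have hpos := hu.pos_symm_last hl hex
      have hπl : π (Fin.last n) ≠ Fin.last n := by
        intro h
        rw [show π.symm (Fin.last n) = Fin.last n from (Equiv.symm_apply_eq π).2 h.symm, hl]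
          at hpos
        exact absurd hpos (by decide)
      have hu' := hu.flipLast
      have hε := hu'.eq_signsAt_last (by simp [lastSign, hπl, hl])
      rw [hε] at hu'
      refine ⟨hu'.weaklyRaising, Or.inr (funext fun j => ?_)⟩
      rw [← lastSign_mul_signsAt, ← hε]
      calc ε j = (lastSign (π j) * lastSign (π j)) * ε j * (lastSign j * lastSign j) := by
            simp only [lastSign_mul_self, one_mul, mul_one]
        _ = _ := by simp only [mul_assoc]
  · rintro ⟨hπ, rfl | rfl⟩
    · exact hπ.eventuallyEmpty
    · have h := hπ.eventuallyEmpty.flipLast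
      simpa only [lastSign_mul_signsAt] using h

end Obstructions

/-! ### Weakly raising permutations are the cycles `cyc I` -/

theorem sortedLT_cyc_list {n : ℕ} (I : Finset (Fin n)) :
    ((I.sort (· ≤ ·)).map Fin.castSucc ++ [Fin.last n]).Pairwise (· < ·) := by
  rw [List.pairwise_append]
  refine ⟨?_, by simp, ?_⟩
  · rw [List.pairwise_map]
    exact (Finset.sortedLT_sort I).pairwise.imp fun h => Fin.castSucc_lt_castSucc_iff.2 h
  · simp [Fin.castSucc_lt_last]

theorem weaklyRaising_cyc {n : ℕ} (I : Finset (Fin n)) : WeaklyRaising (cyc I) := by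
  intro k hk
  unfold cyc
  have hs := sortedLT_cyc_list I
  set l := (I.sort (· ≤ ·)).map Fin.castSucc ++ [Fin.last n] with hl
  by_cases hmem : k ∈ l
  · obtain ⟨m, hm, rfl⟩ := List.getElem_of_mem hmem
    -- Only the final entry r wraps around; every other entry goes to its larger successor.
    have hm' : m + 1 < l.length := by
      by_contra hcon
      apply hk
      have hlen : m = (I.sort (· ≤ ·)).length := by
        simp [hl] at hm hcon ⊢
        omega
      simp [hl, hlen]
    rw [List.formPerm_apply_lt_getElem l (hs.imp fun h => h.ne) m hm']
    exact (List.pairwise_iff_getElem.1 hs m (m + 1) hm hm' (Nat.lt_succ_self m)).le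
  · exact (List.formPerm_apply_of_notMem hmem).ge

theorem cyc_castSucc_eq_self_iff {n : ℕ} (I : Finset (Fin n)) (k : Fin n) :
    cyc I k.castSucc = k.castSucc ↔ k ∉ I := by
  have hmem : k.castSucc ∈ (I.sort (· ≤ ·)).map Fin.castSucc ++ [Fin.last n] ↔ k ∈ I := by
    simp [Fin.castSucc_ne_last]
  constructor
  · intro h hk
    have hne := (List.formPerm_apply_mem_ne_self_iff _ ((sortedLT_cyc_list I).imp fun h => h.ne) _
      (hmem.2 hk)).2 (by simpa using ⟨k, hk⟩)
    exact hne h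
  · exact fun hk => List.formPerm_apply_of_notMem (mt hmem.1 hk)

theorem WeaklyRaising.image_Ico {n : ℕ} {π : Equiv.Perm (Fin (n + 1))} (hπ : WeaklyRaising π)
    {k : Fin (n + 1)} (hk : k ≠ Fin.last n) (hπk : π k ≠ k) :
    (Ico k (Fin.last n)).image π = Ioi k := by
  refine eq_of_subset_of_card_le ?_ ?_
  · intro y hy
    obtain ⟨x, hx, rfl⟩ := mem_image.1 hy
    rw [mem_Ico] at hx
    rw [mem_Ioi]
    rcases hx.1.eq_or_lt with rfl | hlt
    · exact (hπ k hk).lt_of_ne hπk.symm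
    · exact hlt.trans_le (hπ x hx.2.ne)
  · rw [card_image_of_injective _ π.injective, Fin.card_Ico, Fin.card_Ioi]
    simp

/-- Downward induction: if k moves, π maps [k, r) onto (k, r], so σ k = π x with x ≥ k; x > k would
give σ k = σ x. -/
theorem WeaklyRaising.eq_of_fixed_iff {n : ℕ} {π σ : Equiv.Perm (Fin (n + 1))}
    (hπ : WeaklyRaising π) (hσ : WeaklyRaising σ)
    (h : ∀ k, k ≠ Fin.last n → (π k = k ↔ σ k = k)) : π = σ := by
  have key : ∀ k, k ≠ Fin.last n → π k = σ k := by
    intro k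
    induction k using WellFoundedGT.induction with
    | ind k ih =>
      intro hk
      by_cases hfix : π k = k
      · rw [hfix, (h k hk).1 hfix]
      · have hσk : σ k ∈ Ioi k :=
          mem_Ioi.2 ((hσ k hk).lt_of_ne fun hc => hfix ((h k hk).2 hc.symm))
        rw [← hπ.image_Ico hk hfix] at hσk
        obtain ⟨x, hx, hxk⟩ := mem_image.1 hσk
        rw [mem_Ico] at hx
        rcases hx.1.eq_or_lt with rfl | hlt
        · exact hxk
        · rw [ih x hlt hx.2.ne] at hxk
          exact absurd (σ.injective hxk) hlt.ne'
  ext1 k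
  by_cases hk : k = Fin.last n
  · obtain ⟨x, hx⟩ := π.surjective (σ k)
    by_cases hxl : x = Fin.last n
    · rw [hk, ← hxl, hx, hk, hxl]
    · rw [key x hxl] at hx
      exact absurd ((σ.injective hx).trans hk) hxl
  · exact key k hk

theorem cyc_empty {n : ℕ} : cyc (∅ : Finset (Fin n)) = 1 := by
  simp [cyc]

theorem weaklyRaising_iff {n : ℕ} {π : Equiv.Perm (Fin (n + 1))} :
    WeaklyRaising π ↔ ∃ I : Finset (Fin n), π = cyc I := by
  constructor
  · intro hπ
    refine ⟨univ.filter fun k => π k.castSucc ≠ k.castSucc,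
      hπ.eq_of_fixed_iff (weaklyRaising_cyc _) fun k hk => ?_⟩
    obtain ⟨j, rfl⟩ := Fin.exists_castSucc_eq.2 hk
    rw [cyc_castSucc_eq_self_iff]
    simp
  · rintro ⟨I, rfl⟩
    exact weaklyRaising_cyc I

theorem cyc_max' {n : ℕ} (I : Finset (Fin n)) (hI : I.Nonempty) :
    cyc I (I.max' hI).castSucc = Fin.last n := by
  have hne : cyc I (I.max' hI).castSucc ≠ (I.max' hI).castSucc := fun h =>
    (cyc_castSucc_eq_self_iff I _).1 h (I.max'_mem hI)
  have hlt := (weaklyRaising_cyc I _ (Fin.castSucc_ne_last _)).lt_of_ne hne.symm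
  -- An image other than r would exceed max I and so be fixed, contradicting injectivity.
  by_contra hlast
  obtain ⟨j, hj⟩ := Fin.exists_castSucc_eq.2 hlast
  have hjI : j ∉ I := by
    rw [← hj, Fin.castSucc_lt_castSucc_iff] at hlt
    exact fun hmem => hlt.not_ge (I.le_max' j hmem)
  have hfix := (cyc_castSucc_eq_self_iff I j).2 hjI
  rw [hj] at hfix
  exact hne ((cyc I).injective hfix)

theorem cyc_symm_last {n : ℕ} (I : Finset (Fin n)) (hI : I.Nonempty) :
    (cyc I).symm (Fin.last n) = (I.max' hI).castSucc :=
  (Equiv.symm_apply_eq _).2 (cyc_max' I hI).symm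

theorem cyc_ne_one {n : ℕ} (I : Finset (Fin n)) (hI : I.Nonempty) : cyc I ≠ 1 := by
  intro h
  have := cyc_max' I hI
  rw [h, Equiv.Perm.one_apply] at this
  exact Fin.castSucc_ne_last _ this

/-! ### The alternatives in terms of sign vectors -/

section Alternatives

variable {n : ℕ} {ε : Fin (n + 1) → ℤˣ} {π : Equiv.Perm (Fin (n + 1))}

theorem eq_signsAt_iff (m : Fin (n + 1)) :
    ε = signsAt m ↔ ε m = 1 ∧ ∀ j, j ≠ m → ε j = -1 := by
  constructor
  · rintro rfl
    exact ⟨by simp [signsAt], fun j hj => by simp [signsAt, hj]⟩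
  · rintro ⟨h₁, h₂⟩
    funext j
    by_cases hj : j = m
    · simp [signsAt, hj, h₁]
    · simp [signsAt, hj, h₂ j hj]

theorem eq_signsAt_last_iff :
    ε = signsAt (Fin.last n) ↔ (∀ j : Fin n, ε j.castSucc = -1) ∧ ε (Fin.last n) = 1 := by
  rw [eq_signsAt_iff, and_comm]
  refine and_congr_left fun _ => ⟨fun h j => h _ (Fin.castSucc_ne_last j), fun h j hj => ?_⟩
  obtain ⟨i, rfl⟩ := Fin.exists_castSucc_eq.2 hj
  exact h i

theorem altW_iff : AltW ε π ↔ π = 1 ∧ ε = signsAt (Fin.last n) := by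
  rw [AltW, eq_signsAt_last_iff]

theorem altC_iff (I : Finset (Fin n)) :
    AltC ε π I ↔ π = cyc I ∧ ε = signsAt (Fin.last n) := by
  rw [AltC, eq_signsAt_last_iff]

theorem altD_iff (I : Finset (Fin n)) (hI : I.Nonempty) :
    AltD ε π I hI ↔ π = cyc I ∧ ε = signsAt (I.max' hI).castSucc := by
  rw [AltD, eq_signsAt_iff]

theorem signsAt_injective : Function.Injective (signsAt (n := n)) := by
  intro a b h
  by_contra hab
  have := congrFun h a
  simp [signsAt, hab] at this

theorem weaklyRaising_and_signs_iff :
    (WeaklyRaising π ∧ (ε = signsAt (Fin.last n) ∨ ε = signsAt (π.symm (Fin.last n)))) ↔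
      AltW ε π ∨ (∃ I : Finset (Fin n), I.Nonempty ∧ AltC ε π I) ∨
        ∃ (I : Finset (Fin n)) (hI : I.Nonempty), AltD ε π I hI := by
  simp only [altW_iff, altC_iff, altD_iff]
  constructor
  · rintro ⟨hπ, hε⟩
    obtain ⟨I, rfl⟩ := weaklyRaising_iff.1 hπ
    rcases I.eq_empty_or_nonempty with rfl | hI
    · refine Or.inl ⟨cyc_empty, hε.elim id fun h => ?_⟩
      rw [h, cyc_empty]
      rfl
    · rcases hε with h | h
      · exact Or.inr (Or.inl ⟨I, hI, rfl, h⟩)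
      · exact Or.inr (Or.inr ⟨I, hI, rfl, by rw [h, cyc_symm_last I hI]⟩)
  · rintro (⟨rfl, h⟩ | ⟨I, hI, rfl, h⟩ | ⟨I, hI, rfl, h⟩)
    · exact ⟨fun k _ => le_rfl, Or.inl h⟩
    · exact ⟨weaklyRaising_cyc I, Or.inl h⟩
    · exact ⟨weaklyRaising_cyc I, Or.inr (by rw [h, cyc_symm_last I hI])⟩

end Alternatives

/-! ### Recovering the signs, and the parity argument -/

theorem eq_signedPerm {n : ℕ} {u : V n ≃ₗ[ℝ] V n} {ε : Fin (n + 1) → ℤˣ}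
    {π : Equiv.Perm (Fin (n + 1))} (hu : ∀ j, u (e j) = ε j • e (π j)) :
    u = signedPerm ε π := by
  apply LinearEquiv.toLinearMap_injective
  refine (Pi.basisFun ℝ (Fin (n + 1))).ext fun j => ?_
  rw [Pi.basisFun_apply]
  exact (hu j).trans (signedPerm_e ε π j).symm

theorem signedPerm_signs_injective {n : ℕ} {ε δ : Fin (n + 1) → ℤˣ}
    {π σ : Equiv.Perm (Fin (n + 1))} (h : signedPerm ε π = signedPerm δ σ) : ε = δ := by
  funext j
  have hj : ε j • (e (π j) : V n) = δ j • e (σ j) := by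
    rw [← signedPerm_e, ← signedPerm_e, h]
  -- The coordinate sum of ε_j e_{π j} is ε_j, whatever π is.
  have hsum := congrArg (fun v : V n => ∑ t, v t) hj
  simp only [Pi.smul_apply, ← smul_sum, sum_e, mem_univ, if_true] at hsum
  rcases Int.units_eq_one_or (ε j) with h₁ | h₁ <;>
    rcases Int.units_eq_one_or (δ j) with h₂ | h₂ <;>
    simp [h₁, h₂, Units.smul_def] at hsum ⊢ <;> norm_num at hsum

/-- In odd rank, an element of the Weyl group has a positive sign. -/
theorem exists_pos_sign {n : ℕ} (hodd : Odd (n + 1)) {u : weylGroup n} {ε : Fin (n + 1) → ℤˣ}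
    {π : Equiv.Perm (Fin (n + 1))} (hu : u.1 = signedPerm ε π) : ∃ i, ε i = 1 := by
  by_contra! h
  obtain ⟨δ, σ, heven, hδ⟩ := u.2
  obtain rfl := signedPerm_signs_injective (hu.symm.trans hδ)
  rw [filter_true_of_mem fun j _ => (Int.units_eq_one_or _).resolve_left (h j)] at heven
  rw [card_univ, Fintype.card_fin] at heven
  exact Nat.not_even_iff_odd.2 hodd heven

end TypeD

theorem proposition9p1 (n : ℕ) (hr : 5 ≤ n + 1) (hodd : Odd (n + 1))
    (u : TypeD.weylGroup n) (ε : Fin (n + 1) → ℤˣ) (π : Equiv.Perm (Fin (n + 1)))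
    (hu : ∀ j, u.1 (TypeD.e j) = ε j • TypeD.e (π j)) :
    -- the criterion
    (TypeD.IsRational u ↔
      TypeD.AltW ε π ∨
      (∃ I : Finset (Fin n), I.Nonempty ∧ TypeD.AltC ε π I) ∨
      (∃ (I : Finset (Fin n)) (hI : I.Nonempty), TypeD.AltD ε π I hI)) ∧
    -- the alternatives are mutually exclusive
    ¬ (TypeD.AltW ε π ∧ ∃ I : Finset (Fin n), I.Nonempty ∧ TypeD.AltC ε π I) ∧
    ¬ (TypeD.AltW ε π ∧ ∃ (I : Finset (Fin n)) (hI : I.Nonempty), TypeD.AltD ε π I hI) ∧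
    ¬ ((∃ I : Finset (Fin n), I.Nonempty ∧ TypeD.AltC ε π I) ∧
        ∃ (I : Finset (Fin n)) (hI : I.Nonempty), TypeD.AltD ε π I hI) ∧
    -- the elements that they describe
    (TypeD.AltW ε π → u.1 = TypeD.w0 n) ∧
    (∀ I : Finset (Fin n), I.Nonempty → TypeD.AltC ε π I → u.1 = TypeD.cElt I) ∧
    (∀ (I : Finset (Fin n)) (hI : I.Nonempty), TypeD.AltD ε π I hI → u.1 = TypeD.dElt I hI) := by
  have hsp := TypeD.eq_signedPerm hu
  refine ⟨?_, ?_, ?_, ?_, ?_, ?_, ?_⟩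
  · rw [← TypeD.weaklyRaising_and_signs_iff,
      ← TypeD.eventuallyEmpty_signedPerm_iff (TypeD.exists_pos_sign hodd hsp), ← hsp]
    simp only [TypeD.IsRational, TypeD.EventuallyEmpty, TypeD.nu_eq_nuSeq]
  · rintro ⟨hW, I, hI, hC⟩
    exact TypeD.cyc_ne_one I hI (hC.1.symm.trans hW.1)
  · rintro ⟨hW, I, hI, hD⟩
    exact TypeD.cyc_ne_one I hI (hD.1.symm.trans hW.1)
  · rintro ⟨⟨I, -, hC⟩, J, hJ, hD⟩
    rw [TypeD.altC_iff] at hC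
    rw [TypeD.altD_iff] at hD
    exact Fin.castSucc_ne_last _ (TypeD.signsAt_injective (hD.2.symm.trans hC.2))
  · rintro hW
    rw [TypeD.altW_iff] at hW
    rw [hsp, hW.1, hW.2, TypeD.w0]
  · rintro I - hC
    rw [TypeD.altC_iff] at hC
    rw [hsp, hC.1, hC.2, TypeD.cElt]
  · rintro I hI hD
    rw [TypeD.altD_iff] at hD
    rw [hsp, hD.1, hD.2, TypeD.dElt]
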